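/- Let $\{X_n\}_{n\in\mathbb Z}$ be a zero-mean, real-valued, wide sense stationary process with finite second moments on a probability space $(\Omega,\mathfrak F,\mathbb P)$, with covariance sequence $R_k=\mathbb E[X_{n+k}X_n]$. For a zero-mean wide sense stationary process $Y$ with covariance sequence $\{R^Y_k\}$, its spectral density is $S_Y(\lambda)=\sum_{k\in\mathbb Z}R^Y_k e^{-2\pi i\lambda k}$. Let $H_n$ be the closed linear span of $\{X_n,X_{n-1},X_{n-2},\dots\}$ in $L_2(\mathbb P)$ and $H_n^p$ the (closed) linear span of $\{X_n,\dots,X_{n-p+1}\}$. Write $\overline X_n=\overline{\mathbb E}[X_n\mid H_{n-1}]$ and $\overline X_{n,p}=\overline{\mathbb E}[X_n\mid H^p_{n-1}]$ for the orthogonal projections in $L_2(\mathbb P)$ of $X_n$ onto $H_{n-1}$ and $H_{n-1}^p$, i.e. the infinite-order and the order-$p$ minimum mean squared error linear predictors. Assume that $\sum_{k\in\mathbb Z}|R_k|<\infty$ and $S_X(\lambda)>0$ for all $\lambda\in(-\tfrac12,\tfrac12]$. Then the processes $\{\overline X_{n,p}\}_{n\in\mathbb Z}$ (for every $p$) and $\{\overline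 X_n\}_{n\in\mathbb Z}$ are zero-mean and wide sense stationary with absolutely summable covariance sequences, and their spectral densities satisfy $$\lim_{p\to\infty}S_{\overline X_p}(0)=S_{\overline X}(0).$$ Moreover, there are real coefficients $b_{j,p}$ ($1\le j\le p$) and $b_j$ ($j\ge1$) with $\sum_{j\ge1}|b_j|<\infty$, such that for all $n\in\mathbb Z$ one has $\overline X_{n,p}=\sum_{j=1}^p b_{j,p}X_{n-j}$ and $\overline X_n=\sum_{j=1}^\infty b_jX_{n-j}$ (convergence in $L_2(\mathbb P)$), and $$S_{\overline X_p}(0)=\Big(\sum_{j=1}^p b_{j,p}\Big)^2\sum_{k\in\mathbb Z}R_k\;\longrightarrow\;\Big(\sum_{j=1}^\infty b_j\Big)^2\sum_{k\in\mathbb Z}R_k=S_{\overline X}(0)\qquad(p\to\infty).$$ -/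

import Mathlib

open MeasureTheory Filter Topology
open scoped ComplexOrder

noncomputable section

/-- A zero-mean, wide sense stationary, real-valued process indexed by `ℤ`. -/
structure IsWSS {Ω : Type*} [MeasurableSpace Ω] (P : Measure Ω) (Y : ℤ → Ω → ℝ) : Prop where
  memLp : ∀ n, MemLp (Y n) 2 P
  mean_zero : ∀ n, ∫ ω, Y n ω ∂P = 0
  stationary : ∀ m n k : ℤ, ∫ ω, Y (m + k) ω * Y m ω ∂P = ∫ ω, Y (n + k) ω * Y n ω ∂P

/-- The covariance sequence `R_k = E[Y_{n+k} Y_n]` of a wide sense stationary process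
(evaluated at `n = 0`; by stationarity it does not depend on `n`). -/
def autocov {Ω : Type*} [MeasurableSpace Ω] (P : Measure Ω) (Y : ℤ → Ω → ℝ) (k : ℤ) : ℝ :=
  ∫ ω, Y k ω * Y 0 ω ∂P

/-- The spectral density `S(ξ) = ∑_{k ∈ ℤ} R_k e^{-2πiξk}`. -/
def spectralDensity {Ω : Type*} [MeasurableSpace Ω] (P : Measure Ω) (Y : ℤ → Ω → ℝ) (ξ : ℝ) : ℂ :=
  ∑' k : ℤ, (autocov P Y k : ℂ) * Complex.exp (-2 * Real.pi * Complex.I * ξ * k)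

section Prediction

variable {Ω : Type*} [MeasurableSpace Ω] {P : Measure Ω} {X : ℤ → Ω → ℝ}

/-- `H_n`: the closed linear span in `L²(P)` of `X_n, X_{n-1}, X_{n-2}, …`. -/
def pastSpace (hX : ∀ n, MemLp (X n) 2 P) (n : ℤ) : Submodule ℝ (Lp ℝ 2 P) :=
  (Submodule.span ℝ {Z | ∃ k : ℕ, Z = (hX (n - k)).toLp (X (n - k))}).topologicalClosure

/-- `H_n^p`: the closed linear span in `L²(P)` of `X_n, X_{n-1}, …, X_{n-p+1}`. -/
def finPastSpace (hX : ∀ n, MemLp (X n) 2 P) (p : ℕ) (n : ℤ) : Submodule ℝ (Lp ℝ 2 P) :=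
  (Submodule.span ℝ {Z | ∃ k : ℕ, k < p ∧ Z = (hX (n - k)).toLp (X (n - k))}).topologicalClosure

instance (hX : ∀ n, MemLp (X n) 2 P) (n : ℤ) : (pastSpace hX n).HasOrthogonalProjection := by
  unfold pastSpace; infer_instance

instance (hX : ∀ n, MemLp (X n) 2 P) (p : ℕ) (n : ℤ) :
    (finPastSpace hX p n).HasOrthogonalProjection := by
  unfold finPastSpace; infer_instance

/-- The infinite-order predictor: the orthogonal projection of `X_n` onto `H_{n-1}`. -/
def predictor (hX : ∀ n, MemLp (X n) 2 P) (n : ℤ) : Lp ℝ 2 P :=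
  (pastSpace hX (n - 1)).starProjection ((hX n).toLp (X n))

/-- The predictor of order `p`: the orthogonal projection of `X_n` onto `H_{n-1}^p`. -/
def finPredictor (hX : ∀ n, MemLp (X n) 2 P) (p : ℕ) (n : ℤ) : Lp ℝ 2 P :=
  (finPastSpace hX p (n - 1)).starProjection ((hX n).toLp (X n))

end Prediction

end

/-! The spectral density is continuous and positive on a compact circle, so it is bounded below by
some `c > 0`, and every finite Toeplitz section of the covariances is bounded below by `c` in ℓ²
(`exists_posDef_of_fourier_pos`). The crux is to upgrade this to an ℓ¹ bound uniform in the section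
(`exists_sum_abs_le_of_posDef`). The quadratic form is tested on `x` damped by weights `θ ^ |i -
k|`. For `θ` near 1 these almost commute with the convolution, because `R` is summable; summing over
the centres `k`, the commutator is absorbed into the left side.

Predictor coefficients solve the Yule–Walker equations. Stability makes the finite systems solvable,
gives by compactness an ℓ¹ solution of the half-line system, and yields Baxter's inequality: the
truncated infinite solution differs from the order-`p` one in ℓ¹ by at most a constant times the
tail of the infinite solution (`tendsto_sum_finite_section`). No spectral factorization is needed.
An ℓ¹ filter multiplies the sum of the covariances by the square of its coefficient sum
(`IsWSS.hasSum_autocov_filtered`), so convergence of coefficient sums is convergence of the spectral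
densities at 0. -/

lemma HasSum.of_forall_eq {ι M : Type*} [AddCommMonoid M] [TopologicalSpace M] {f g : ι → M} {s : M}
    (hf : HasSum f s) (h : ∀ i, f i = g i) : HasSum g s :=
  funext h ▸ hf

/-! ### Uniform ℓ¹ stability of Toeplitz sections -/

/-- Exponential weights vary slowly: the difference of two translates is controlled by their sum. -/
lemma abs_pow_natAbs_sub_le {θ : ℝ} (h0 : 0 ≤ θ) (h1 : θ ≤ 1) (m d : ℤ) :
    |θ ^ m.natAbs - θ ^ (m + d).natAbs| ≤
      (1 - θ ^ d.natAbs) * (θ ^ m.natAbs + θ ^ (m + d).natAbs) := by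
  have hd : θ ^ d.natAbs ≤ 1 := pow_le_one₀ h0 h1
  -- Both bounds are the triangle inequality in the exponent, since `θ ≤ 1`.
  have e1 : θ ^ d.natAbs * θ ^ m.natAbs ≤ θ ^ (m + d).natAbs := by
    rw [← pow_add]; exact pow_le_pow_of_le_one h0 h1 (by omega)
  have e2 : θ ^ d.natAbs * θ ^ (m + d).natAbs ≤ θ ^ m.natAbs := by
    rw [← pow_add]; exact pow_le_pow_of_le_one h0 h1 (by omega)
  have p1 : 0 ≤ (1 - θ ^ d.natAbs) * θ ^ m.natAbs := mul_nonneg (by linarith) (by positivity)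
  have p2 : 0 ≤ (1 - θ ^ d.natAbs) * θ ^ (m + d).natAbs := mul_nonneg (by linarith) (by positivity)
  rw [abs_le]
  constructor <;> linarith

lemma summable_pow_natAbs {θ : ℝ} (h0 : 0 ≤ θ) (h1 : θ < 1) :
    Summable fun k : ℤ => θ ^ k.natAbs := by
  apply Summable.of_nat_of_neg
  · simpa using summable_geometric_of_lt_one h0 h1
  · simpa using summable_geometric_of_lt_one h0 h1

/-- The commutator constants `∑ |R d| (1 - θ^|d|)` become small as `θ → 1`. -/
lemma exists_tsum_mul_one_sub_pow_lt {R : ℤ → ℝ} (hR : Summable fun k => |R k|) {ε : ℝ}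
    (hε : 0 < ε) :
    ∃ θ : ℝ, 0 ≤ θ ∧ θ < 1 ∧ ∑' d : ℤ, |R d| * (1 - θ ^ d.natAbs) < ε := by
  have key : Tendsto (fun θ : ℝ => ∑' d : ℤ, |R d| * (1 - θ ^ d.natAbs)) (𝓝[<] 1)
      (𝓝 (∑' d : ℤ, |R d| * (1 - 1 ^ d.natAbs))) := by
    apply tendsto_tsum_of_dominated_convergence hR
    · intro d
      apply Tendsto.mono_left _ nhdsWithin_le_nhds
      exact (Continuous.tendsto (by fun_prop) (1 : ℝ))
    · filter_upwards [Ioo_mem_nhdsLT (show (0 : ℝ) < 1 by norm_num)] with θ hθ d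
      have h1 : θ ^ d.natAbs ≤ 1 := pow_le_one₀ hθ.1.le hθ.2.le
      have h2 : 0 ≤ θ ^ d.natAbs := pow_nonneg hθ.1.le _
      rw [Real.norm_eq_abs, abs_mul, abs_abs]
      apply mul_le_of_le_one_right (abs_nonneg _)
      rw [abs_le]; constructor <;> linarith
  simp only [one_pow, sub_self, mul_zero, tsum_zero] at key
  obtain ⟨θ, h, h'⟩ := ((key.eventually_lt_const hε).and
    (Ioo_mem_nhdsLT (show (0 : ℝ) < 1 by norm_num))).exists
  exact ⟨θ, h'.1.le, h'.2, h⟩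

lemma sqrt_sum_sq_le_sum_abs {ι : Type*} (I : Finset ι) (u : ι → ℝ) :
    √(∑ i ∈ I, u i ^ 2) ≤ ∑ i ∈ I, |u i| := by
  rw [Real.sqrt_le_left (Finset.sum_nonneg fun _ _ => abs_nonneg _)]
  simpa only [sq_abs] using
    Finset.sum_sq_le_sq_sum_of_nonneg (s := I) (f := fun i => |u i|) fun _ _ => abs_nonneg _

lemma sqrt_sum_add_sq_le {ι : Type*} (I : Finset ι) (u v : ι → ℝ) :
    √(∑ i ∈ I, (u i + v i) ^ 2) ≤ √(∑ i ∈ I, u i ^ 2) + √(∑ i ∈ I, v i ^ 2) := by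
  have := Real.Lp_add_le I u v (p := 2) (by norm_num)
  simpa [Real.sqrt_eq_rpow] using this

/-- A double sum over a finite set of integers, grouped by the difference of the indices. -/
lemma sum_sum_mul_le_sum_shift {I D : Finset ℤ} (hD : ∀ i ∈ I, ∀ j ∈ I, i - j ∈ D)
    {r : ℤ → ℝ} (hr : ∀ d, 0 ≤ r d) {u : ℤ → ℝ} {v : ℤ → ℤ → ℝ} {M : ℤ → ℝ}
    (hM : ∀ d, √(∑ j ∈ I, v d j ^ 2) ≤ M d) :
    ∑ i ∈ I, ∑ j ∈ I, r (i - j) * (u i * v (i - j) j) ≤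
      √(∑ i ∈ I, u i ^ 2) * ∑ d ∈ D, r d * M d := by
  classical
  -- Extension by zero lets each translate of `u` be compared with `u` in ℓ²; Cauchy–Schwarz is then
  -- applied separately for each difference `d`.
  set u' : ℤ → ℝ := fun i => if i ∈ I then u i else 0 with hu'
  have h1 : ∀ j ∈ I, ∑ i ∈ I, r (i - j) * (u i * v (i - j) j) =
      ∑ d ∈ D, r d * (u' (d + j) * v d j) := by
    intro j hj
    have : ∑ d ∈ D, r d * (u' (d + j) * v d j) =
        ∑ i ∈ D.map (addRightEmbedding j), r (i - j) * (u' i * v (i - j) j) := by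
      simp [Finset.sum_map]
    have hsub : I ⊆ D.map (addRightEmbedding j) := fun i hi =>
      Finset.mem_map.2 ⟨i - j, hD i hi j hj, by simp⟩
    rw [this, ← Finset.sum_subset hsub fun i _ hi => by simp [hu', hi]]
    exact Finset.sum_congr rfl fun i hi => by simp [hu', hi]
  have h2 : ∀ d, ∑ j ∈ I, u' (d + j) ^ 2 ≤ ∑ i ∈ I, u i ^ 2 := by
    intro d
    have : ∑ j ∈ I, u' (d + j) ^ 2 = ∑ i ∈ I.map (addLeftEmbedding d), u' i ^ 2 := by
      simp [Finset.sum_map]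
    rw [this]
    calc ∑ i ∈ I.map (addLeftEmbedding d), u' i ^ 2
        ≤ ∑ i ∈ I ∪ I.map (addLeftEmbedding d), u' i ^ 2 :=
          Finset.sum_le_sum_of_subset_of_nonneg Finset.subset_union_right
            fun _ _ _ => sq_nonneg _
      _ = ∑ i ∈ I, u' i ^ 2 := by
          symm
          apply Finset.sum_subset Finset.subset_union_left
          intro i _ hi
          simp [hu', hi]
      _ = ∑ i ∈ I, u i ^ 2 := Finset.sum_congr rfl fun i hi => by simp [hu', hi]
  rw [Finset.sum_comm, Finset.sum_congr rfl h1, Finset.sum_comm, Finset.mul_sum]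
  refine Finset.sum_le_sum fun d _ => ?_
  rw [← Finset.mul_sum, mul_left_comm]
  refine mul_le_mul_of_nonneg_left ?_ (hr d)
  calc ∑ j ∈ I, u' (d + j) * v d j
      ≤ √(∑ j ∈ I, u' (d + j) ^ 2) * √(∑ j ∈ I, v d j ^ 2) :=
        Real.sum_mul_le_sqrt_mul_sqrt _ _ _
    _ ≤ √(∑ i ∈ I, u i ^ 2) * M d :=
        mul_le_mul (Real.sqrt_le_sqrt (h2 d)) (hM d) (Real.sqrt_nonneg _) (Real.sqrt_nonneg _)

/-- The localized energy estimate: exponentially weighted `ℓ²` norms of `x` are controlled by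
those of its image under the compressed convolution, up to a commutator term. -/
lemma weighted_norm_le {R : ℤ → ℝ} {c : ℝ}
    (hpos : ∀ (I : Finset ℤ) (x : ℤ → ℝ),
      c * ∑ i ∈ I, x i ^ 2 ≤ ∑ i ∈ I, ∑ j ∈ I, R (i - j) * (x i * x j))
    {θ : ℝ} (h0 : 0 ≤ θ) (h1 : θ ≤ 1) {I D : Finset ℤ} (hD : ∀ i ∈ I, ∀ j ∈ I, i - j ∈ D)
    (x : ℤ → ℝ) {N : ℤ → ℝ} (hN : ∀ k, N k = √(∑ i ∈ I, (θ ^ (i - k).natAbs * x i) ^ 2)) (k : ℤ) :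
    c * N k ≤ ∑ i ∈ I, θ ^ (i - k).natAbs * |∑ j ∈ I, R (i - j) * x j| +
      ∑ d ∈ D, (|R d| * (1 - θ ^ d.natAbs)) * (N k + N (k - d)) := by
  set w : ℤ → ℝ := fun i => θ ^ (i - k).natAbs with hw
  have hw0 : ∀ i, 0 ≤ w i := fun i => pow_nonneg h0 _
  have hN0 : 0 ≤ N k := by rw [hN]; exact Real.sqrt_nonneg _
  have hNsq : N k ^ 2 = ∑ i ∈ I, (w i * x i) ^ 2 := by
    rw [hN, Real.sq_sqrt (Finset.sum_nonneg fun _ _ => sq_nonneg _)]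
  have hle : ∀ i ∈ I, |w i * x i| ≤ N k := by
    intro i hi
    rw [hN]
    apply Real.abs_le_sqrt
    exact Finset.single_le_sum (f := fun i => (w i * x i) ^ 2) (fun _ _ => sq_nonneg _) hi
  have main : c * N k ^ 2 ≤ N k * (∑ i ∈ I, w i * |∑ j ∈ I, R (i - j) * x j| +
      ∑ d ∈ D, (|R d| * (1 - θ ^ d.natAbs)) * (N k + N (k - d))) := by
    calc c * N k ^ 2 ≤ ∑ i ∈ I, ∑ j ∈ I, R (i - j) * ((w i * x i) * (w j * x j)) := by
          rw [hNsq]; exact hpos I fun i => w i * x i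
      -- Writing `w j = w i + (w j - w i)` separates the weighted image of `x` from the commutator.
      _ = ∑ i ∈ I, (w i * x i) * (w i * ∑ j ∈ I, R (i - j) * x j) +
          ∑ i ∈ I, ∑ j ∈ I, R (i - j) * ((w i * x i) * ((w j - w i) * x j)) := by
          rw [← Finset.sum_add_distrib]
          refine Finset.sum_congr rfl fun i _ => ?_
          rw [Finset.mul_sum, Finset.mul_sum, ← Finset.sum_add_distrib]
          exact Finset.sum_congr rfl fun j _ => by ring
      _ ≤ ∑ i ∈ I, N k * (w i * |∑ j ∈ I, R (i - j) * x j|) +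
          ∑ i ∈ I, ∑ j ∈ I, (|R (i - j)| * (1 - θ ^ (i - j).natAbs)) *
            (|w i * x i| * (w j * |x j| + θ ^ (j - (k - (i - j))).natAbs * |x j|)) := by
          refine add_le_add (Finset.sum_le_sum fun i hi => ?_)
            (Finset.sum_le_sum fun i _ => Finset.sum_le_sum fun j _ => ?_)
          · refine (le_abs_self _).trans ?_
            rw [abs_mul, abs_mul (w i) (Finset.sum _ _), abs_of_nonneg (hw0 i)]
            exact mul_le_mul_of_nonneg_right (hle i hi) (mul_nonneg (hw0 i) (abs_nonneg _))
          · refine (le_abs_self _).trans ?_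
            rw [abs_mul, abs_mul (w i * x i), abs_mul (w j - w i)]
            have hb := abs_pow_natAbs_sub_le h0 h1 (j - k) (i - j)
            have e1 : j - k + (i - j) = i - k := by ring
            -- The weight at `i` centred at `k` is the weight at `j` centred at `k - d` with `d = i
            -- - j`; this produces `N (k - d)`.
            have e2 : j - (k - (i - j)) = i - k := by ring
            rw [e1] at hb
            rw [e2]
            have : |R (i - j)| * (|w i * x i| * (|w j - w i| * |x j|)) ≤
              |R (i - j)| * (|w i * x i| * (((1 - θ ^ (i - j).natAbs) * (w j + w i)) * |x j|)) := by
              gcongr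
            refine this.trans (le_of_eq ?_)
            simp only [hw]
            ring
      _ ≤ _ := by
          rw [← Finset.mul_sum, mul_add]
          refine add_le_add le_rfl ?_
          have := sum_sum_mul_le_sum_shift hD (r := fun d => |R d| * (1 - θ ^ d.natAbs))
            (fun d => mul_nonneg (abs_nonneg _) (sub_nonneg.2 (pow_le_one₀ h0 h1)))
            (u := fun i => |w i * x i|)
            (v := fun d j => w j * |x j| + θ ^ (j - (k - d)).natAbs * |x j|)
            (M := fun d => N k + N (k - d)) (fun d => by
              refine (sqrt_sum_add_sq_le _ _ _).trans (le_of_eq ?_)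
              simp only [hN, mul_pow, sq_abs, hw])
          refine this.trans (le_of_eq ?_)
          simp only [sq_abs]
          rw [← hNsq, Real.sqrt_sq hN0]
  rcases hN0.eq_or_lt with h | h
  · rw [← h, mul_zero]
    refine add_nonneg (Finset.sum_nonneg fun i _ => mul_nonneg (hw0 i) (abs_nonneg _))
      (Finset.sum_nonneg fun d _ => mul_nonneg (mul_nonneg (abs_nonneg _)
        (sub_nonneg.2 (pow_le_one₀ h0 h1))) ?_)
    rw [zero_add, hN]
    exact Real.sqrt_nonneg _
  · refine le_of_mul_le_mul_left ?_ h
    linarith [main]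

/-- Uniform `ℓ¹` stability of the finite sections of a positive definite convolution operator with
summable kernel. -/
theorem exists_sum_abs_le_of_posDef {R : ℤ → ℝ} (hR : Summable fun k => |R k|) {c : ℝ} (hc : 0 < c)
    (hpos : ∀ (I : Finset ℤ) (x : ℤ → ℝ),
      c * ∑ i ∈ I, x i ^ 2 ≤ ∑ i ∈ I, ∑ j ∈ I, R (i - j) * (x i * x j)) :
    ∃ C : ℝ, 0 ≤ C ∧ ∀ (I : Finset ℤ) (x : ℤ → ℝ),
      ∑ i ∈ I, |x i| ≤ C * ∑ i ∈ I, |∑ j ∈ I, R (i - j) * x j| := by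
  -- After summation over `k` the commutator counts `∑ N` twice, so `c / 4` costs `c / 2` and leaves
  -- `c / 2`, whence the factor `2 / c`.
  obtain ⟨θ, h0, h1, hθ⟩ := exists_tsum_mul_one_sub_pow_lt hR (ε := c / 4) (by linarith)
  have hW := summable_pow_natAbs h0 h1
  set W := ∑' k : ℤ, θ ^ k.natAbs with hWdef
  have hW0 : 0 ≤ W := tsum_nonneg fun k => pow_nonneg h0 _
  have hWi : ∀ i : ℤ, HasSum (fun k : ℤ => θ ^ (i - k).natAbs) W := fun i =>
    (Equiv.subLeft i).hasSum_iff (f := fun k : ℤ => θ ^ k.natAbs) |>.2 hW.hasSum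
  refine ⟨2 / c * W, by positivity, fun I x => ?_⟩
  set y : ℤ → ℝ := fun i => ∑ j ∈ I, R (i - j) * x j with hy
  set N : ℤ → ℝ := fun k => √(∑ i ∈ I, (θ ^ (i - k).natAbs * x i) ^ 2) with hN
  set D : Finset ℤ := (I ×ˢ I).image fun q => q.1 - q.2 with hDdef
  have hD : ∀ i ∈ I, ∀ j ∈ I, i - j ∈ D := fun i hi j hj =>
    Finset.mem_image.2 ⟨(i, j), Finset.mk_mem_product hi hj, rfl⟩
  have hNs : Summable N := by
    refine Summable.of_nonneg_of_le (fun k => Real.sqrt_nonneg _)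
      (fun k => sqrt_sum_sq_le_sum_abs I _) ?_
    refine summable_sum fun i _ => ?_
    simp only [abs_mul, abs_of_nonneg (pow_nonneg h0 _)]
    exact (hWi i).summable.mul_right _
  have hshift : ∀ d, HasSum (fun k => N (k - d)) (∑' k, N k) := fun d =>
    (Equiv.subRight d).hasSum_iff (f := N) |>.2 hNs.hasSum
  have hrhs : HasSum (fun k => ∑ i ∈ I, θ ^ (i - k).natAbs * |y i| +
      ∑ d ∈ D, (|R d| * (1 - θ ^ d.natAbs)) * (N k + N (k - d)))
      (∑ i ∈ I, W * |y i| +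
        ∑ d ∈ D, (|R d| * (1 - θ ^ d.natAbs)) * (∑' k, N k + ∑' k, N k)) :=
    (hasSum_sum fun i _ => (hWi i).mul_right _).add
      (hasSum_sum fun d _ => (hNs.hasSum.add (hshift d)).mul_left _)
  have hk : ∀ k, c * N k ≤ ∑ i ∈ I, θ ^ (i - k).natAbs * |y i| +
      ∑ d ∈ D, (|R d| * (1 - θ ^ d.natAbs)) * (N k + N (k - d)) := fun k =>
    weighted_norm_le hpos h0 h1.le hD x (N := N) (fun _ => rfl) k
  have hsum := hasSum_le hk (hNs.hasSum.mul_left c) hrhs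
  have hS0 : 0 ≤ ∑' k, N k := tsum_nonneg fun k => Real.sqrt_nonneg _
  have hterm : ∀ d : ℤ, 0 ≤ |R d| * (1 - θ ^ d.natAbs) := fun d =>
    mul_nonneg (abs_nonneg _) (sub_nonneg.2 (pow_le_one₀ h0 h1.le))
  have hDle : ∑ d ∈ D, |R d| * (1 - θ ^ d.natAbs) ≤ c / 4 := by
    refine le_trans (Summable.sum_le_tsum D (fun d _ => hterm d) ?_) hθ.le
    refine Summable.of_nonneg_of_le hterm (fun d => ?_) hR
    exact mul_le_of_le_one_right (abs_nonneg _) (by linarith [pow_nonneg h0 d.natAbs])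
  rw [← Finset.mul_sum, ← Finset.sum_mul] at hsum
  have hmul := mul_le_mul_of_nonneg_right hDle (add_nonneg hS0 hS0)
  -- The weight centred at `i` equals 1 at `i`, so `|x i| ≤ N i`.
  have hx : ∑ i ∈ I, |x i| ≤ ∑' k, N k := by
    refine le_trans (Finset.sum_le_sum fun i hi => ?_)
      (Summable.sum_le_tsum I (fun k _ => Real.sqrt_nonneg _) hNs)
    refine Real.abs_le_sqrt ?_
    have := Finset.single_le_sum (f := fun j => (θ ^ (j - i).natAbs * x j) ^ 2)
      (fun _ _ => sq_nonneg _) hi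
    simpa using this
  refine hx.trans ?_
  rw [div_mul_eq_mul_div, div_mul_eq_mul_div, le_div_iff₀ hc]
  linarith

/-! ### Finite and half-line convolution equations -/

/-- The restriction of the `ℓ¹` stability estimate to index sets `{0, …, p - 1}`. -/
lemma sum_range_abs_le {R : ℤ → ℝ} {C : ℝ}
    (hC : ∀ (I : Finset ℤ) (x : ℤ → ℝ),
      ∑ i ∈ I, |x i| ≤ C * ∑ i ∈ I, |∑ j ∈ I, R (i - j) * x j|) (p : ℕ) (x : ℕ → ℝ) :
    ∑ i ∈ Finset.range p, |x i| ≤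
      C * ∑ i ∈ Finset.range p, |∑ j ∈ Finset.range p, R (i - j) * x j| := by
  simpa [Finset.sum_map] using hC ((Finset.range p).map Nat.castEmbedding) fun i => x i.toNat

/-- `∑_{i < p} |∑_j R (i - j) z_j| ≤ ‖R‖₁ ‖z‖₁`. -/
lemma sum_abs_tsum_mul_le {R : ℤ → ℝ} (hR : Summable fun k => |R k|) {z : ℕ → ℝ}
    (hz : Summable fun j => |z j|) (p : ℕ) :
    ∑ i ∈ Finset.range p, |∑' j : ℕ, R (i - j) * z j| ≤ (∑' k, |R k|) * ∑' j, |z j| := by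
  have hRle : ∀ k, |R k| ≤ ∑' k, |R k| := fun k => hR.le_tsum k fun _ _ => abs_nonneg _
  have hs : ∀ i : ℤ, Summable fun j : ℕ => |R (i - j) * z j| := fun i => by
    refine Summable.of_nonneg_of_le (fun _ => abs_nonneg _) (fun j => ?_)
      (hz.mul_left (∑' k, |R k|))
    rw [abs_mul]
    exact mul_le_mul_of_nonneg_right (hRle _) (abs_nonneg _)
  calc ∑ i ∈ Finset.range p, |∑' j : ℕ, R (i - j) * z j|
      ≤ ∑ i ∈ Finset.range p, ∑' j : ℕ, |R (i - j) * z j| :=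
        Finset.sum_le_sum fun i _ => norm_tsum_le_tsum_norm (f := fun j : ℕ => R (i - j) * z j) (hs i)
    _ = ∑' j : ℕ, ∑ i ∈ Finset.range p, |R (i - j) * z j| :=
        (Summable.tsum_finsetSum fun (i : ℕ) _ => hs i).symm
    _ ≤ ∑' j : ℕ, (∑' k, |R k|) * |z j| := by
        refine Summable.tsum_le_tsum (fun j => ?_) (summable_sum fun i _ => hs i)
          (hz.mul_left _)
        simp only [abs_mul]
        rw [← Finset.sum_mul]
        refine mul_le_mul_of_nonneg_right ?_ (abs_nonneg _)
        -- For fixed `j` the differences `i - j` are distinct, so a column sum is at most `‖R‖₁`.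
        have he : Function.Injective fun i : ℕ => (i : ℤ) - j := fun a b h => by
          simpa using h
        have := hR.sum_le_tsum ((Finset.range p).map ⟨_, he⟩) fun _ _ => abs_nonneg _
        simpa [Finset.sum_map] using this
    _ = _ := tsum_mul_left

/-- Solutions of the finite sections of a stable convolution equation with summable right-hand side
have, along an ultrafilter, a summable pointwise limit which solves the half-line equation. -/
lemma exists_summable_solution {R : ℤ → ℝ} (hR : Summable fun k => |R k|) {C : ℝ} (hC0 : 0 ≤ C)
    (hC : ∀ (I : Finset ℤ) (x : ℤ → ℝ),
      ∑ i ∈ I, |x i| ≤ C * ∑ i ∈ I, |∑ j ∈ I, R (i - j) * x j|)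
    {r : ℕ → ℝ} (hr : Summable fun i => |r i|) {ap : ℕ → ℕ → ℝ}
    (hap : ∀ p, ∀ i < p, ∑ j ∈ Finset.range p, R (i - j) * ap p j = r i) :
    ∃ a : ℕ → ℝ, (Summable fun j => |a j|) ∧ ∀ i : ℕ, ∑' j : ℕ, R (i - j) * a j = r i := by
  set B := C * ∑' i, |r i| with hB
  set q : ℕ → ℕ → ℝ := fun p j => if j < p then ap p j else 0 with hq
  have hqsum : ∀ p, ∑ i ∈ Finset.range p, |q p i| ≤ B := fun p => by
    refine (sum_range_abs_le hC p (q p)).trans (mul_le_mul_of_nonneg_left ?_ hC0)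
    refine le_trans (le_of_eq (Finset.sum_congr rfl fun i hi => ?_))
      (hr.sum_le_tsum (Finset.range p) fun _ _ => abs_nonneg _)
    rw [← hap p i (Finset.mem_range.1 hi)]
    congr 1
    exact Finset.sum_congr rfl fun j hj => by simp [hq, Finset.mem_range.1 hj]
  have hqs : ∀ p (s : Finset ℕ), ∑ i ∈ s, |q p i| ≤ B := fun p s => by
    refine le_trans ?_ (hqsum p)
    rw [← Finset.sum_filter_add_sum_filter_not s (· < p)]
    have h2 : ∑ i ∈ s with ¬ i < p, |q p i| = 0 := Finset.sum_eq_zero fun i hi => by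
      simp [hq, (Finset.mem_filter.1 hi).2]
    rw [h2, add_zero]
    exact Finset.sum_le_sum_of_subset_of_nonneg
      (fun i hi => Finset.mem_range.2 (Finset.mem_filter.1 hi).2) fun _ _ _ => abs_nonneg _
  have hqB : ∀ p j, |q p j| ≤ B := fun p j => by simpa using hqs p {j}
  -- Along one ultrafilter all bounded coordinates converge at once, with no diagonal extraction.
  set U : Ultrafilter ℕ := Ultrafilter.of atTop with hU
  have hlim : ∀ j, ∃ y, Tendsto (fun p => q p j) U (𝓝 y) := fun j => by
    obtain ⟨y, -, hy⟩ := (isCompact_Icc (a := -B) (b := B)).ultrafilter_le_nhds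
      (U.map fun p => q p j) (by
        refine le_principal_iff.2 (Filter.mem_map.2 (Filter.univ_mem' fun p => ?_))
        exact abs_le.1 (hqB p j))
    exact ⟨y, hy⟩
  choose a ha using hlim
  refine ⟨a, summable_of_sum_le (fun _ => abs_nonneg _) (c := B) fun s => ?_, fun i => ?_⟩
  · exact le_of_tendsto (tendsto_finsetSum s fun j _ => (ha j).abs)
      (Filter.Eventually.of_forall fun p => hqs p s)
  -- A uniform bound on the coefficients suffices for domination, because `R` is itself summable.
  · have hRi : Summable fun j : ℕ => |R (i - j)| * B := by
      refine Summable.mul_right B ?_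
      exact hR.comp_injective (i := fun j : ℕ => (i : ℤ) - j) fun a b h => by simpa using h
    have h1 : Tendsto (fun p => ∑' j : ℕ, R (i - j) * q p j) U
        (𝓝 (∑' j : ℕ, R (i - j) * a j)) := by
      refine tendsto_tsum_of_dominated_convergence hRi (fun j => (ha j).const_mul _)
        (Filter.Eventually.of_forall fun p j => ?_)
      rw [Real.norm_eq_abs, abs_mul]
      exact mul_le_mul_of_nonneg_left (hqB p j) (abs_nonneg _)
    refine tendsto_nhds_unique (h1.congr' ?_) tendsto_const_nhds
    have hle : (U : Filter ℕ) ≤ atTop := Ultrafilter.of_le atTop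
    filter_upwards [hle (eventually_gt_atTop i)] with p hp
    rw [tsum_eq_sum (s := Finset.range p) fun j hj => by
      simp [hq, not_lt.1 (Finset.mem_range.not.1 hj)]]
    rw [← hap p i hp]
    exact Finset.sum_congr rfl fun j hj => by simp [hq, Finset.mem_range.1 hj]

/-- Baxter's inequality yields convergence of the sums of the finite section solutions. -/
lemma tendsto_sum_finite_section {R : ℤ → ℝ} (hR : Summable fun k => |R k|) {C : ℝ} (hC0 : 0 ≤ C)
    (hC : ∀ (I : Finset ℤ) (x : ℤ → ℝ),
      ∑ i ∈ I, |x i| ≤ C * ∑ i ∈ I, |∑ j ∈ I, R (i - j) * x j|)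
    {r : ℕ → ℝ} {ap : ℕ → ℕ → ℝ}
    (hap : ∀ p, ∀ i < p, ∑ j ∈ Finset.range p, R (i - j) * ap p j = r i)
    {a : ℕ → ℝ} (ha : Summable fun j => |a j|)
    (hsol : ∀ i : ℕ, ∑' j : ℕ, R (i - j) * a j = r i) :
    Tendsto (fun p => ∑ j ∈ Finset.range p, ap p j) atTop (𝓝 (∑' j, a j)) := by
  have hRle : ∀ k, |R k| ≤ ∑' k, |R k| := fun k => hR.le_tsum k fun _ _ => abs_nonneg _
  have hs : ∀ i : ℤ, Summable fun j : ℕ => R (i - j) * a j := fun i => by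
    refine Summable.of_norm_bounded (ha.mul_left (∑' k, |R k|)) fun j => ?_
    rw [Real.norm_eq_abs, abs_mul]
    exact mul_le_mul_of_nonneg_right (hRle _) (abs_nonneg _)
  have key : ∀ p, |∑ j ∈ Finset.range p, ap p j - ∑ j ∈ Finset.range p, a j| ≤
      C * ((∑' k, |R k|) * ∑' j, |a (j + p)|) := fun p => by
    -- The tail of `a` from `p` on: on rows `i < p` the two equations share the right-hand side, so
    -- the section applied to `ap p - a` is `R` convolved with this tail.
    set z : ℕ → ℝ := fun j => if j < p then 0 else a j with hz
    have hzs : Summable fun j => |z j| := by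
      refine Summable.of_nonneg_of_le (fun _ => abs_nonneg _) (fun j => ?_) ha
      by_cases h : j < p <;> simp [hz, h]
    have hzt : ∑' j, |z j| = ∑' j, |a (j + p)| := by
      rw [← hzs.sum_add_tsum_nat_add p, Finset.sum_eq_zero fun j hj => by
        simp [hz, Finset.mem_range.1 hj], zero_add]
      simp [hz]
    have hres : ∀ i ∈ Finset.range p,
        |∑ j ∈ Finset.range p, R (i - j) * (ap p j - a j)| = |∑' j : ℕ, R (i - j) * z j| := by
      intro i hi
      congr 1
      simp only [mul_sub, Finset.sum_sub_distrib]
      have hzi : Summable fun j : ℕ => R (i - j) * z j := by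
        refine Summable.of_norm_bounded (hs i).norm fun j => ?_
        by_cases h : j < p
        · simpa [hz, h] using mul_nonneg (abs_nonneg _) (abs_nonneg _)
        · simp [hz, h]
      rw [hap p i (Finset.mem_range.1 hi), ← hsol i, ← (hs i).sum_add_tsum_nat_add p,
        ← hzi.sum_add_tsum_nat_add p, Finset.sum_eq_zero (f := fun j : ℕ => R (i - j) * z j)
          fun j hj => by simp [hz, Finset.mem_range.1 hj], add_sub_cancel_left, zero_add]
      simp [hz]
    rw [← Finset.sum_sub_distrib, ← hzt]
    refine (Finset.abs_sum_le_sum_abs _ _).trans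
      ((sum_range_abs_le hC p fun j => ap p j - a j).trans
        (mul_le_mul_of_nonneg_left ?_ hC0))
    rw [Finset.sum_congr rfl hres]
    exact sum_abs_tsum_mul_le hR hzs p
  have htail : Tendsto (fun p => C * ((∑' k, |R k|) * ∑' j, |a (j + p)|)) atTop (𝓝 0) := by
    have := ((tendsto_sum_nat_add fun j => |a j|).const_mul (∑' k, |R k|)).const_mul C
    simpa using this
  have hdiff : Tendsto (fun p => ∑ j ∈ Finset.range p, ap p j - ∑ j ∈ Finset.range p, a j) atTop
      (𝓝 0) := squeeze_zero_norm key htail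
  simpa using hdiff.add (Summable.of_abs ha).hasSum.tendsto_sum_nat

/-- The finite sections of a stable convolution equation are solvable. -/
lemma exists_finite_section_solution {R : ℤ → ℝ} {C : ℝ}
    (hC : ∀ (I : Finset ℤ) (x : ℤ → ℝ),
      ∑ i ∈ I, |x i| ≤ C * ∑ i ∈ I, |∑ j ∈ I, R (i - j) * x j|) (r : ℕ → ℝ) (p : ℕ) :
    ∃ a : ℕ → ℝ, ∀ i < p, ∑ j ∈ Finset.range p, R (i - j) * a j = r i := by
  set ext : (Fin p → ℝ) → ℕ → ℝ := fun v j => if h : j < p then v ⟨j, h⟩ else 0 with hext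
  set M : Matrix (Fin p) (Fin p) ℝ := Matrix.of fun i j => R ((i : ℕ) - (j : ℕ)) with hM
  have hmul : ∀ (v : Fin p → ℝ) (i : Fin p),
      ∑ j ∈ Finset.range p, R ((i : ℕ) - j) * ext v j = M.mulVec v i := fun v i => by
    rw [Finset.sum_range, Matrix.mulVec, dotProduct]
    exact Finset.sum_congr rfl fun j _ => by simp [hext, hM]
  -- Stability makes the kernel trivial; a square matrix is then invertible.
  have hinj : Function.Injective M.mulVec := by
    refine (injective_iff_map_eq_zero (M.mulVecLin)).2 fun v hv => ?_
    have h := sum_range_abs_le hC p (ext v)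
    rw [Finset.sum_eq_zero (f := fun i : ℕ => |∑ j ∈ Finset.range p, R (i - j) * ext v j|)
      fun i hi => by
        have := hmul v ⟨i, Finset.mem_range.1 hi⟩
        have h0 : M.mulVec v = 0 := hv
        rw [h0] at this
        simpa using this, mul_zero] at h
    have h0 := (Finset.sum_eq_zero_iff_of_nonneg fun _ _ => abs_nonneg _).1
      (le_antisymm h (Finset.sum_nonneg fun _ _ => abs_nonneg _))
    funext i
    simpa [hext] using h0 i (Finset.mem_range.2 i.2)
  obtain ⟨v, hv⟩ := Matrix.mulVec_surjective_iff_isUnit.2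
    (Matrix.mulVec_injective_iff_isUnit.1 hinj) fun i => r i
  refine ⟨ext v, fun i hi => ?_⟩
  rw [hmul v ⟨i, hi⟩, hv]

/-! ### Positive definiteness from the Fourier transform -/

lemma integral_fourier (n : ℤ) :
    ∫ t : UnitAddCircle, fourier n t ∂AddCircle.haarAddCircle = if n = 0 then 1 else 0 := by
  have h := congrFun (fourierCoeff_fourier (T := 1) n) 0
  rw [fourierCoeff] at h
  simp only [neg_zero, fourier_zero, one_smul] at h
  rw [h, Pi.single_apply]
  simp [eq_comm]

/-- A summable sequence with nonnegative Fourier transform is positive semidefinite. -/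
lemma sum_sum_nonneg_of_fourier_nonneg {R : ℤ → ℝ} (hR : Summable fun k => |R k|)
    {F : UnitAddCircle → ℝ} (hF : ∀ t, HasSum (fun k => (R k : ℂ) * fourier (-k) t) (F t))
    (h0 : ∀ t, 0 ≤ F t) (I : Finset ℤ) (x : ℤ → ℝ) :
    0 ≤ ∑ i ∈ I, ∑ j ∈ I, R (i - j) * (x i * x j) := by
  set μ : Measure UnitAddCircle := AddCircle.haarAddCircle with hμ
  set q : UnitAddCircle → ℂ := fun t => ∑ i ∈ I, (x i : ℂ) * fourier i t with hq
  have hQ : ∀ t, ((‖q t‖ ^ 2 : ℝ) : ℂ) =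
      ∑ i ∈ I, ∑ j ∈ I, ((x i * x j : ℝ) : ℂ) * fourier (i - j) t := fun t => by
    rw [Complex.ofReal_pow, ← Complex.mul_conj', hq]
    simp only [map_sum, map_mul, Complex.conj_ofReal, Finset.sum_mul_sum]
    refine Finset.sum_congr rfl fun i _ => Finset.sum_congr rfl fun j _ => ?_
    rw [sub_eq_add_neg, fourier_add, fourier_neg]
    push_cast
    ring
  -- Orthogonality of characters: only the pairs with `i - j = k` survive. Summing over `k`
  -- identifies the Toeplitz form with the integral of `F * ‖q‖ ^ 2`.
  have hterm : ∀ k, ∫ t, ((R k : ℂ) * fourier (-k) t) * ((‖q t‖ ^ 2 : ℝ) : ℂ) ∂μ =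
      ∑ i ∈ I, ∑ j ∈ I, if k = i - j then ((R (i - j) * (x i * x j) : ℝ) : ℂ) else 0 := fun k => by
    have : ∀ t, ((R k : ℂ) * fourier (-k) t) * ((‖q t‖ ^ 2 : ℝ) : ℂ) =
        ∑ i ∈ I, ∑ j ∈ I, ((R k * (x i * x j) : ℝ) : ℂ) * fourier (-k + (i - j)) t := fun t => by
      rw [hQ, Finset.mul_sum]
      refine Finset.sum_congr rfl fun i _ => ?_
      rw [Finset.mul_sum]
      refine Finset.sum_congr rfl fun j _ => ?_
      rw [fourier_add]
      push_cast
      ring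
    simp_rw [this]
    have hint : ∀ (c : ℂ) (n : ℤ), Integrable (fun t : UnitAddCircle => c * fourier n t) μ :=
      fun c n => (Continuous.integrable_of_hasCompactSupport (by fun_prop)
        (HasCompactSupport.of_compactSpace _))
    rw [integral_finsetSum _ fun i _ => integrable_finsetSum _ fun j _ => hint _ _]
    refine Finset.sum_congr rfl fun i _ => ?_
    rw [integral_finsetSum _ fun j _ => hint _ _]
    refine Finset.sum_congr rfl fun j _ => ?_
    rw [integral_const_mul, hμ, integral_fourier]
    by_cases h : k = i - j
    · subst h; simp
    · rw [if_neg h, if_neg (by omega), mul_zero]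
  have hcont : Continuous q := by fun_prop
  obtain ⟨M, hM⟩ := isCompact_univ.exists_bound_of_continuousOn (f := fun t => ‖q t‖ ^ 2)
    (by fun_prop)
  have hsum := hasSum_integral_of_dominated_convergence (μ := μ)
    (F := fun k t => ((R k : ℂ) * fourier (-k) t) * ((‖q t‖ ^ 2 : ℝ) : ℂ))
    (f := fun t => (F t : ℂ) * ((‖q t‖ ^ 2 : ℝ) : ℂ)) (fun k _ => |R k| * M)
    (fun k => Continuous.aestronglyMeasurable (by fun_prop))
    (fun k => Filter.Eventually.of_forall fun t => by
      have h1 : ‖fourier (-k) t‖ = 1 := Circle.norm_coe _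
      have h2 := hM t (Set.mem_univ _)
      rw [norm_mul, norm_mul, h1, mul_one, Complex.norm_real, Complex.norm_real, Real.norm_eq_abs]
      exact mul_le_mul_of_nonneg_left h2 (abs_nonneg _))
    (Filter.Eventually.of_forall fun t => hR.mul_right M)
    (integrable_const _)
    (Filter.Eventually.of_forall fun t => (hF t).mul_right _)
  simp only [hterm] at hsum
  have hsum' : HasSum (fun k => ∑ i ∈ I, ∑ j ∈ I,
      if k = i - j then ((R (i - j) * (x i * x j) : ℝ) : ℂ) else 0)
      (∑ i ∈ I, ∑ j ∈ I, ((R (i - j) * (x i * x j) : ℝ) : ℂ)) :=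
    hasSum_sum fun i _ => hasSum_sum fun j _ => hasSum_ite_eq (i - j) _
  have heq := hsum'.unique hsum
  have hreal : ∫ t, (F t : ℂ) * ((‖q t‖ ^ 2 : ℝ) : ℂ) ∂μ =
      ((∫ t, F t * ‖q t‖ ^ 2 ∂μ : ℝ) : ℂ) := by
    rw [← integral_complex_ofReal]
    exact integral_congr_ae (Filter.Eventually.of_forall fun t => by push_cast; ring)
  rw [hreal] at heq
  have : ∑ i ∈ I, ∑ j ∈ I, R (i - j) * (x i * x j) = ∫ t, F t * ‖q t‖ ^ 2 ∂μ := by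
    exact_mod_cast heq
  rw [this]
  exact integral_nonneg fun t => mul_nonneg (h0 t) (sq_nonneg _)

/-- A summable sequence with positive Fourier transform is uniformly positive definite. -/
theorem exists_posDef_of_fourier_pos {R : ℤ → ℝ} (hR : Summable fun k => |R k|)
    (hpos : ∀ t : UnitAddCircle, 0 < ∑' k : ℤ, (R k : ℂ) * fourier (-k) t) :
    ∃ c : ℝ, 0 < c ∧ ∀ (I : Finset ℤ) (x : ℤ → ℝ),
      c * ∑ i ∈ I, x i ^ 2 ≤ ∑ i ∈ I, ∑ j ∈ I, R (i - j) * (x i * x j) := by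
  have hbound : ∀ k (t : UnitAddCircle), ‖(R k : ℂ) * fourier (-k) t‖ ≤ |R k| := fun k t => by
    have h1 : ‖fourier (-k) t‖ = 1 := Circle.norm_coe _
    rw [norm_mul, h1, mul_one, Complex.norm_real, Real.norm_eq_abs]
  set F : UnitAddCircle → ℂ := fun t => ∑' k : ℤ, (R k : ℂ) * fourier (-k) t with hFdef
  have hF : ∀ t, HasSum (fun k => (R k : ℂ) * fourier (-k) t) (F t) := fun t =>
    (Summable.of_norm_bounded hR fun k => hbound k t).hasSum
  have hcont : Continuous F := continuous_tsum (fun k => by fun_prop) hR hbound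
  obtain ⟨t₀, -, ht₀⟩ := isCompact_univ.exists_isMinOn Set.univ_nonempty
    (Complex.continuous_re.comp hcont).continuousOn
  -- Positivity in the order on `ℂ` includes vanishing of the imaginary part.
  have hre : ∀ t, F t = ((F t).re : ℂ) := fun t => by
    have := (Complex.pos_iff.1 (hpos t)).2
    exact Complex.ext rfl this.symm
  refine ⟨(F t₀).re, (Complex.pos_iff.1 (hpos t₀)).1, fun I x => ?_⟩
  set c := (F t₀).re
  -- Lowering the coefficient at 0 by `c` lowers the transform by its minimum, leaving it
  -- nonnegative, and the form by `c * ∑ x i ^ 2`.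
  have hR' : Summable fun k : ℤ => |R k - if k = 0 then c else 0| := by
    refine Summable.abs ((Summable.of_abs hR).sub (hasSum_ite_eq (0 : ℤ) c).summable)
  have := sum_sum_nonneg_of_fourier_nonneg hR' (F := fun t => (F t).re - c) (fun t => by
      have h := (hF t).sub (hasSum_ite_eq (0 : ℤ) (c : ℂ))
      rw [hre t, ← Complex.ofReal_sub] at h
      refine h.of_forall_eq fun k => ?_
      by_cases hk : k = 0 <;> simp [hk]) (fun t => sub_nonneg.2 (ht₀ (Set.mem_univ t))) I x
  simp only [sub_mul, Finset.sum_sub_distrib, sub_eq_zero, ite_mul, zero_mul] at this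
  have h2 : ∑ i ∈ I, ∑ j ∈ I, (if i = j then c * (x i * x j) else 0) = c * ∑ i ∈ I, x i ^ 2 := by
    rw [Finset.mul_sum]
    refine Finset.sum_congr rfl fun i hi => ?_
    rw [Finset.sum_ite_eq, if_pos hi, sq]
  rw [h2] at this
  linarith

/-- Positivity of the spectral density transferred to the circle. -/
lemma fourier_pos_of_spectralDensity_pos {Ω : Type*} [MeasurableSpace Ω] {P : Measure Ω}
    {X : ℤ → Ω → ℝ} (hpos : ∀ ξ ∈ Set.Ioc (-1 / 2 : ℝ) (1 / 2), 0 < spectralDensity P X ξ)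
    (t : UnitAddCircle) : 0 < ∑' k : ℤ, (autocov P X k : ℂ) * fourier (-k) t := by
  obtain ⟨ξ, hξ, rfl⟩ : ∃ ξ ∈ Set.Ioc (-1 / 2 : ℝ) (1 / 2), (ξ : UnitAddCircle) = t := by
    have := AddCircle.coe_image_Ioc_eq (1 : ℝ) (-1 / 2)
    have ht : t ∈ (Set.image QuotientAddGroup.mk (Set.Ioc (-1 / 2 : ℝ) (-1 / 2 + 1)) : Set UnitAddCircle) :=
      this ▸ Set.mem_univ t
    obtain ⟨ξ, hξ, h⟩ := ht
    exact ⟨ξ, ⟨hξ.1, by linarith [hξ.2]⟩, h⟩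
  convert hpos ξ hξ using 1
  rw [spectralDensity]
  refine tsum_congr fun k => ?_
  rw [fourier_coe_apply]
  congr 2
  push_cast
  ring

/-! ### Linear filters of a stationary process -/

section Processes

variable {Ω : Type*} [MeasurableSpace Ω] {P : Measure Ω} {X : ℤ → Ω → ℝ}

/-- The random variable `X n` as an element of `L²(P)`. -/
noncomputable def IsWSS.toLp (hX : IsWSS P X) (n : ℤ) : Lp ℝ 2 P := (hX.memLp n).toLp (X n)

lemma L2_inner_eq_integral_mul (f g : Lp ℝ 2 P) : inner ℝ f g = ∫ ω, f ω * g ω ∂P := by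
  rw [L2.inner_def]
  exact integral_congr_ae (Eventually.of_forall fun ω => by simp [mul_comm])

/-- Exhibits expectation as a continuous functional on `L²`, so that zero mean survives infinite
sums. -/
lemma L2_inner_one_eq_integral [IsProbabilityMeasure P] (f : Lp ℝ 2 P) :
    inner ℝ (indicatorConstLp 2 MeasurableSet.univ (measure_ne_top P Set.univ) (1 : ℝ)) f =
      ∫ ω, f ω ∂P := by
  rw [L2.inner_indicatorConstLp_one, setIntegral_univ]

namespace IsWSS

lemma inner_toLp (hX : IsWSS P X) (m n : ℤ) :
    inner ℝ (hX.toLp m) (hX.toLp n) = autocov P X (m - n) := by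
  have h := hX.stationary n 0 (m - n)
  rw [add_sub_cancel, zero_add] at h
  rw [autocov, ← h, L2_inner_eq_integral_mul]
  refine integral_congr_ae ?_
  filter_upwards [(hX.memLp m).coeFn_toLp, (hX.memLp n).coeFn_toLp] with ω h1 h2
  rw [IsWSS.toLp, IsWSS.toLp, h1, h2]

lemma autocov_neg (hX : IsWSS P X) (k : ℤ) : autocov P X (-k) = autocov P X k := by
  have h1 := hX.inner_toLp 0 k
  have h2 := hX.inner_toLp k 0
  rw [zero_sub] at h1
  rw [sub_zero] at h2
  rw [← h1, ← h2, real_inner_comm]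

lemma integral_toLp (hX : IsWSS P X) (n : ℤ) : ∫ ω, hX.toLp n ω ∂P = 0 := by
  rw [← hX.mean_zero n]
  exact integral_congr_ae (hX.memLp n).coeFn_toLp

lemma norm_toLp (hX : IsWSS P X) (n : ℤ) : ‖hX.toLp n‖ = √(autocov P X 0) := by
  rw [norm_eq_sqrt_real_inner, hX.inner_toLp, sub_self]

lemma summable_smul_toLp (hX : IsWSS P X) {a : ℕ → ℝ} (ha : Summable fun j => |a j|) (n : ℤ) :
    Summable fun j : ℕ => a j • hX.toLp (n - (j + 1 : ℕ)) := by
  refine Summable.of_norm ?_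
  simp only [norm_smul, hX.norm_toLp, Real.norm_eq_abs]
  exact ha.mul_right _

variable {a : ℕ → ℝ} {Y : ℤ → Lp ℝ 2 P}

/-- The covariances of a linearly filtered process. -/
lemma inner_filtered (hX : IsWSS P X)
    (hY : ∀ n, HasSum (fun j : ℕ => a j • hX.toLp (n - (j + 1 : ℕ))) (Y n)) (m n : ℤ) :
    inner ℝ (Y m) (Y n) = ∑' i : ℕ, ∑' j : ℕ, a i * a j * autocov P X (m - n - i + j) := by
  have h1 : ∀ i : ℕ, HasSum (fun j : ℕ => a i * a j * autocov P X (m - n - i + j))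
      (a i * inner ℝ (hX.toLp (m - (i + 1 : ℕ))) (Y n)) := fun i => by
    have := ((innerSL ℝ (hX.toLp (m - (i + 1 : ℕ)))).hasSum (hY n)).mul_left (a i)
    refine this.of_forall_eq fun j => ?_
    simp only [innerSL_apply_apply, real_inner_smul_right, hX.inner_toLp]
    rw [mul_assoc]
    congr 3
    push_cast
    ring
  have h2 : HasSum (fun i : ℕ => a i * inner ℝ (hX.toLp (m - (i + 1 : ℕ))) (Y n))
      (inner ℝ (Y m) (Y n)) := by
    have := (innerSL ℝ (Y n)).hasSum (hY m)
    simp only [innerSL_apply_apply] at this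
    rw [real_inner_comm] at this
    refine this.of_forall_eq fun i => ?_
    simp only [real_inner_smul_right]
    rw [real_inner_comm]
  rw [← h2.tsum_eq]
  exact tsum_congr fun i => (h1 i).tsum_eq.symm

/-- The covariance formula involves the times only through `m - n`, which gives stationarity; the
mean passes through the series by continuity. -/
lemma isWSS_filtered [IsProbabilityMeasure P] (hX : IsWSS P X)
    (hY : ∀ n, HasSum (fun j : ℕ => a j • hX.toLp (n - (j + 1 : ℕ))) (Y n)) :
    IsWSS P (fun n => Y n) where
  memLp n := Lp.memLp (Y n)
  mean_zero n := by
    rw [← L2_inner_one_eq_integral]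
    have := (innerSL ℝ (indicatorConstLp 2 MeasurableSet.univ
      (measure_ne_top P Set.univ) (1 : ℝ))).hasSum (hY n)
    refine this.unique (hasSum_zero.of_forall_eq fun j => ?_)
    symm
    simp only [innerSL_apply_apply, real_inner_smul_right]
    rw [L2_inner_one_eq_integral, hX.integral_toLp, mul_zero]
  stationary m n k := by
    rw [← L2_inner_eq_integral_mul, ← L2_inner_eq_integral_mul, hX.inner_filtered hY,
      hX.inner_filtered hY, add_sub_cancel_left, add_sub_cancel_left]

/-- Filtering multiplies the sum of the covariances by the squared sum of the coefficients. -/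
lemma hasSum_autocov_filtered (hX : IsWSS P X) (hR : Summable fun k : ℤ => |autocov P X k|)
    (ha : Summable fun j => |a j|)
    (hY : ∀ n, HasSum (fun j : ℕ => a j • hX.toLp (n - (j + 1 : ℕ))) (Y n)) :
    HasSum (autocov P fun n => Y n) ((∑' j, a j) ^ 2 * ∑' k : ℤ, autocov P X k) := by
  set R := autocov P X with hRdef
  -- This absolutely summable array is summed in two orders: over `k` first it gives the product,
  -- over `(i, j)` first the covariances.
  set G : (ℕ × ℕ) × ℤ → ℝ := fun z => a z.1.1 * a z.1.2 * R (z.2 - z.1.1 + z.1.2) with hG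
  have hshift : ∀ (f : ℤ → ℝ), Summable f → ∀ i j : ℕ,
      HasSum (fun k : ℤ => f (k - i + j)) (∑' k, f k) := fun f hf i j =>
    (((Equiv.subRight (i : ℤ)).trans (Equiv.addRight (j : ℤ))).hasSum_iff (f := f)).2 hf.hasSum
  have haa : Summable fun q : ℕ × ℕ => |a q.1| * |a q.2| :=
    ha.mul_of_nonneg ha (fun _ => abs_nonneg _) fun _ => abs_nonneg _
  have haa' : HasSum (fun q : ℕ × ℕ => a q.1 * a q.2) ((∑' j, a j) ^ 2) := by
    have hs : Summable fun q : ℕ × ℕ => a q.1 * a q.2 :=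
      Summable.of_abs (by simpa only [abs_mul] using haa)
    rw [sq, (Summable.of_abs ha).tsum_mul_tsum (Summable.of_abs ha) hs]
    exact hs.hasSum
  have hGs : Summable G := by
    refine Summable.of_abs ((summable_prod_of_nonneg fun _ => abs_nonneg _).2 ⟨fun q => ?_, ?_⟩)
    · simp only [hG, abs_mul]
      exact (hshift (fun k => |R k|) hR q.1 q.2).summable.mul_left _
    · have : ∀ q : ℕ × ℕ, ∑' k : ℤ, |G (q, k)| = |a q.1| * |a q.2| * ∑' k, |R k| := fun q => by
        simp only [hG, abs_mul]
        exact ((hshift (fun k => |R k|) hR q.1 q.2).mul_left _).tsum_eq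
      simp only [this]
      exact haa.mul_right _
  have htotal : ∑' z, G z = (∑' j, a j) ^ 2 * ∑' k, R k :=
    (hGs.hasSum.prod_fiberwise fun q =>
      (hshift R (Summable.of_abs hR) q.1 q.2).mul_left (a q.1 * a q.2)).unique
        (haa'.mul_right _)
  have hGswap : Summable fun z : ℤ × (ℕ × ℕ) => G (z.2, z.1) := hGs.prod_symm
  have hfib : ∀ k, HasSum (fun q => G (q, k)) (autocov P (fun n => Y n) k) := fun k => by
    have hk : Summable fun q => G (q, k) := hGswap.prod_factor k
    have : autocov P (fun n => Y n) k = ∑' q, G (q, k) := by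
      rw [hk.tsum_prod, autocov, ← L2_inner_eq_integral_mul, hX.inner_filtered hY, sub_zero]
    rw [this]
    exact hk.hasSum
  rw [← htotal]
  exact ((Equiv.prodComm ℤ (ℕ × ℕ)).hasSum_iff.2 hGs.hasSum).prod_fiberwise hfib

end IsWSS

lemma spectralDensity_zero (P : Measure Ω) (Y : ℤ → Ω → ℝ) :
    spectralDensity P Y 0 = ((∑' k, autocov P Y k : ℝ) : ℂ) := by
  simp [spectralDensity, Complex.ofReal_tsum]

/-! ### Predictors and the Yule–Walker equations -/

/-- Orthogonality to a family extends to its closed linear span. -/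
lemma inner_eq_zero_of_mem_closure_span {E : Type*} [NormedAddCommGroup E] [InnerProductSpace ℝ E]
    {S : Set E} {u : E} (h : ∀ v ∈ S, inner ℝ u v = 0) :
    ∀ w ∈ (Submodule.span ℝ S).topologicalClosure, inner ℝ u w = 0 := by
  intro w hw
  have hle : (Submodule.span ℝ S).topologicalClosure ≤ (ℝ ∙ u)ᗮ :=
    Submodule.topologicalClosure_minimal _
      (Submodule.span_le.2 fun v hv => Submodule.mem_orthogonal_singleton_iff_inner_right.2 (h v hv))
      (Submodule.isClosed_orthogonal _)
  exact Submodule.mem_orthogonal_singleton_iff_inner_right.1 (hle hw)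

namespace IsWSS

/-- Solutions of the finite Yule–Walker equations give the predictor of order `p`. -/
lemma finPredictor_eq (hX : IsWSS P X) {p : ℕ} {a : ℕ → ℝ}
    (ha : ∀ i < p, ∑ j ∈ Finset.range p, autocov P X ((i : ℤ) - j) * a j = autocov P X (i + 1))
    (n : ℤ) :
    finPredictor hX.memLp p n = ∑ j ∈ Finset.range p, a j • hX.toLp (n - (j + 1 : ℕ)) := by
  refine Submodule.eq_starProjection_of_mem_of_inner_eq_zero ?_
    (inner_eq_zero_of_mem_closure_span ?_)
  · refine Submodule.sum_mem _ fun j hj => Submodule.smul_mem _ _ ?_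
    refine Submodule.le_topologicalClosure _ (Submodule.subset_span ⟨j, Finset.mem_range.1 hj, ?_⟩)
    exact congrArg hX.toLp (by push_cast; ring)
  · rintro _ ⟨i, hi, rfl⟩
    -- Orthogonality of the residual to `X (n - 1 - i)` is exactly the `i`-th Yule–Walker equation;
    -- `a j` multiplies `X (n - (j + 1))`.
    change inner ℝ (hX.toLp n - _) (hX.toLp (n - 1 - i)) = 0
    rw [inner_sub_left, hX.inner_toLp, sum_inner, sub_eq_zero]
    rw [show n - (n - 1 - i) = (i : ℤ) + 1 by ring, ← ha i hi]
    refine Finset.sum_congr rfl fun j _ => ?_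
    rw [real_inner_smul_left, hX.inner_toLp, mul_comm]
    congr 2
    push_cast
    ring

/-- Summable solutions of the infinite Yule–Walker equations give the infinite-order predictor. -/
lemma hasSum_predictor (hX : IsWSS P X) {a : ℕ → ℝ} (hs : Summable fun j => |a j|)
    (ha : ∀ i : ℕ, ∑' j : ℕ, autocov P X ((i : ℤ) - j) * a j = autocov P X (i + 1)) (n : ℤ) :
    HasSum (fun j : ℕ => a j • hX.toLp (n - (j + 1 : ℕ))) (predictor hX.memLp n) := by
  have hsum := (hX.summable_smul_toLp hs n).hasSum
  convert hsum using 1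
  refine Submodule.eq_starProjection_of_mem_of_inner_eq_zero ?_
    (inner_eq_zero_of_mem_closure_span ?_)
  · refine (Submodule.isClosed_topologicalClosure _).mem_of_tendsto hsum
      (Eventually.of_forall fun s => Submodule.sum_mem _ fun j _ => Submodule.smul_mem _ _ ?_)
    refine Submodule.le_topologicalClosure _ (Submodule.subset_span ⟨j, ?_⟩)
    exact congrArg hX.toLp (by push_cast; ring)
  · rintro _ ⟨i, rfl⟩
    change inner ℝ (hX.toLp n - _) (hX.toLp (n - 1 - i)) = 0
    rw [inner_sub_left, hX.inner_toLp, sub_eq_zero,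
      show n - (n - 1 - i) = (i : ℤ) + 1 by ring, ← ha i, real_inner_comm]
    have := (innerSL ℝ (hX.toLp (n - 1 - i))).hasSum hsum
    refine (this.of_forall_eq fun j => ?_).tsum_eq
    simp only [innerSL_apply_apply, real_inner_smul_right, hX.inner_toLp]
    rw [mul_comm, ← hX.autocov_neg]
    congr 2
    push_cast
    ring

end IsWSS

end Processes

/-! ### Assembly of the main theorem -/

lemma sum_Icc_one_eq_sum_range {M : Type*} [AddCommMonoid M] (f : ℕ → M) (p : ℕ) :
    ∑ j ∈ Finset.Icc 1 p, f j = ∑ j ∈ Finset.range p, f (j + 1) := by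
  induction p with
  | zero => simp
  | succ p ih => rw [Finset.sum_Icc_succ_top (by omega), ih, Finset.sum_range_succ]

theorem mainTheorem2 {Ω : Type*} [MeasurableSpace Ω] (P : Measure Ω) [IsProbabilityMeasure P]
    (X : ℤ → Ω → ℝ) (hX : IsWSS P X)
    (hpos : ∀ ξ ∈ Set.Ioc (-1 / 2 : ℝ) (1 / 2), 0 < spectralDensity P X ξ)
    (hsum : Summable fun k : ℤ => |autocov P X k|) :
    -- the predictors form stationary processes with summable covariances,
    -- so that their spectral densities at the origin are meaningful
    (∀ p : ℕ, IsWSS P (fun n => finPredictor hX.memLp p n) ∧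
      Summable fun k : ℤ => |autocov P (fun n => finPredictor hX.memLp p n) k|) ∧
    (IsWSS P (fun n => predictor hX.memLp n) ∧
      Summable fun k : ℤ => |autocov P (fun n => predictor hX.memLp n) k|) ∧
    -- convergence of the spectral densities at the origin
    Tendsto (fun p : ℕ => spectralDensity P (fun n => finPredictor hX.memLp p n) 0) atTop
      (𝓝 (spectralDensity P (fun n => predictor hX.memLp n) 0)) ∧
    -- the values in terms of the autoregressive coefficients (`b j`, `bp p j` for `j ≥ 1`)
    ∃ (b : ℕ → ℝ) (bp : ℕ → ℕ → ℝ),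
      (∀ (p : ℕ) (n : ℤ), finPredictor hX.memLp p n =
        ∑ j ∈ Finset.Icc 1 p, bp p j • (hX.memLp (n - j)).toLp (X (n - j))) ∧
      (∀ n : ℤ, HasSum
        (fun j : ℕ => b (j + 1) • (hX.memLp (n - (j + 1 : ℕ))).toLp (X (n - (j + 1 : ℕ))))
        (predictor hX.memLp n)) ∧
      (Summable fun j : ℕ => |b (j + 1)|) ∧
      (∀ p : ℕ, spectralDensity P (fun n => finPredictor hX.memLp p n) 0 =
        (((∑ j ∈ Finset.Icc 1 p, bp p j) ^ 2 * ∑' k : ℤ, autocov P X k : ℝ) : ℂ)) ∧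
      spectralDensity P (fun n => predictor hX.memLp n) 0 =
        (((∑' j : ℕ, b (j + 1)) ^ 2 * ∑' k : ℤ, autocov P X k : ℝ) : ℂ) ∧
      Tendsto (fun p : ℕ => (∑ j ∈ Finset.Icc 1 p, bp p j) ^ 2 * ∑' k : ℤ, autocov P X k) atTop
        (𝓝 ((∑' j : ℕ, b (j + 1)) ^ 2 * ∑' k : ℤ, autocov P X k)) := by
  set R := autocov P X with hRdef
  obtain ⟨c, hc, hpd⟩ := exists_posDef_of_fourier_pos hsum (fourier_pos_of_spectralDensity_pos hpos)
  obtain ⟨C, hC0, hC⟩ := exists_sum_abs_le_of_posDef hsum hc hpd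
  have hr : Summable fun i : ℕ => |R (i + 1)| :=
    hsum.comp_injective (i := fun i : ℕ => (i : ℤ) + 1) fun a b h => by simpa using h
  choose ap hap using exists_finite_section_solution hC fun i => R (i + 1)
  obtain ⟨a, ha, hsol⟩ := exists_summable_solution hsum hC0 hC hr hap
  have hlim := tendsto_sum_finite_section hsum hC0 hC hap ha hsol
  have hpred := hX.hasSum_predictor ha hsol
  have hfin : ∀ p n, finPredictor hX.memLp p n =
      ∑ j ∈ Finset.range p, ap p j • hX.toLp (n - (j + 1 : ℕ)) := fun p =>
    hX.finPredictor_eq (hap p)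
  -- Padding by zero makes the order-`p` predictor an infinite filter, so the same filter lemmas
  -- serve both predictors.
  set q : ℕ → ℕ → ℝ := fun p j => if j < p then ap p j else 0 with hq
  have hq0 : ∀ p, ∀ j ∉ Finset.range p, q p j = 0 := fun p j hj =>
    if_neg (Finset.mem_range.not.1 hj)
  have hq1 : ∀ p, ∀ j ∈ Finset.range p, q p j = ap p j := fun p j hj =>
    if_pos (Finset.mem_range.1 hj)
  have hqs : ∀ p, Summable fun j => |q p j| := fun p =>
    summable_of_ne_finset_zero (s := Finset.range p) fun j hj => by rw [hq0 p j hj, abs_zero]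
  have hqt : ∀ p, ∑' j, q p j = ∑ j ∈ Finset.range p, ap p j := fun p => by
    rw [tsum_eq_sum (hq0 p), Finset.sum_congr rfl (hq1 p)]
  have hfin' : ∀ p n, HasSum (fun j : ℕ => q p j • hX.toLp (n - (j + 1 : ℕ)))
      (finPredictor hX.memLp p n) := fun p n => by
    rw [hfin, Finset.sum_congr rfl fun j hj => by rw [← hq1 p j hj]]
    exact hasSum_sum_of_ne_finset_zero fun j hj => by rw [hq0 p j hj, zero_smul]
  have hcovfin := fun p => hX.hasSum_autocov_filtered hsum (hqs p) (hfin' p)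
  have hcov := hX.hasSum_autocov_filtered hsum ha hpred
  have hSfin : ∀ p, spectralDensity P (fun n => finPredictor hX.memLp p n) 0 =
      (((∑ j ∈ Finset.range p, ap p j) ^ 2 * ∑' k : ℤ, R k : ℝ) : ℂ) := fun p => by
    rw [spectralDensity_zero, (hcovfin p).tsum_eq, hqt]
  have hS : spectralDensity P (fun n => predictor hX.memLp n) 0 =
      (((∑' j : ℕ, a j) ^ 2 * ∑' k : ℤ, R k : ℝ) : ℂ) := by
    rw [spectralDensity_zero, hcov.tsum_eq]
  have hlim' : Tendsto (fun p : ℕ => (∑ j ∈ Finset.range p, ap p j) ^ 2 * ∑' k : ℤ, R k) atTop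
      (𝓝 ((∑' j : ℕ, a j) ^ 2 * ∑' k : ℤ, R k)) := (hlim.pow 2).mul_const _
  -- The coefficients were indexed from 0, hence the shift `j - 1`; the value at `j = 0` is never
  -- used.
  refine ⟨fun p => ⟨hX.isWSS_filtered (hfin' p), (hcovfin p).summable.abs⟩,
    ⟨hX.isWSS_filtered hpred, hcov.summable.abs⟩, ?_, fun j => a (j - 1), fun p j => ap p (j - 1),
    fun p n => ?_, hpred, ha, fun p => ?_, hS, ?_⟩
  · simp only [hSfin, hS]
    exact (Complex.continuous_ofReal.tendsto _).comp hlim'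
  · rw [hfin, sum_Icc_one_eq_sum_range]
    rfl
  · rw [hSfin, sum_Icc_one_eq_sum_range]
    rfl
  · simp only [sum_Icc_one_eq_sum_range]
    exact hlim'
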